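/- Let $(E,\mathcal E,m)$ and $(E_\partial,\mathcal E_\partial,m_\partial)$ be $\sigma$-finite measure spaces, $L^1=L^1(E,m)$, $L^1_\partial=L^1(E_\partial,m_\partial)$, and let $\|(f,f_\partial)\|=\|f\|+\|f_\partial\|$ on $L^1\times L^1_\partial$. Let $\mathcal D$ be a linear subspace of $L^1$, let $A\colon\mathcal D\to L^1$ be linear, and let $B\colon\mathcal D\to L^1$ and $\Psi_0,\Psi\colon\mathcal D\to L^1_\partial$ be linear and positive. Assume: (i) the restriction $A_0$ of $A$ to $\mathcal D(A_0)=\{f\in\mathcal D:\Psi_0f=0\}$ is the generator of a substochastic semigroup on $L^1$, i.e. of a $C_0$-semigroup of positive operators $S(t)$ with $\|S(t)f\|\le\|f\|$ for $f\ge 0$; (ii) if $\Psi_0\not\equiv0$, then for each $\lambda>0$ there is a positive linear operator $\Psi(\lambda)\colon L^1_\partial\to\operatorname{Ker}(\lambda-A)=\{f\in\mathcal D:\lambda f-Af=0\}$ with $\Psi_0\Psi(\lambda)f_\partial=f_\partial$ for all $f_\partial\in L^1_\partial$ (it is then unique; put $\Psi(\lambda)=0$ if $\Psi_0\equiv0$);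 (iii) $\int_E(Af+Bf)\,dm+\int_{E_\partial}(\Psi f-\Psi_0f)\,dm_\partial\le0$ for each nonnegative $f\in\mathcal D$. Write $R(\lambda,\cdot)$ for resolvents. Let $\{P(t)\}_{t\ge0}$ be the perturbed semigroup, that is, the substochastic semigroup on $L^1$ whose generator $G$ has the resolvent $$R(\lambda,G)f=\lim_{N\to\infty}\sum_{n=0}^N\bigl(R(\lambda,A_0)B+\Psi(\lambda)\Psi\bigr)^nR(\lambda,A_0)f,\qquad f\in L^1,\ \lambda>0,$$ and let $K$ be the operator on $L^1\times L^1_\partial$ given by $$K(f,f_\partial)=\lim_{\lambda\downarrow0}\,(Bu_\lambda,\Psi u_\lambda),\qquad u_\lambda=R(\lambda,A_0)f+\Psi(\lambda)f_\partial .$$ For nonnegative $f\in L^1$, not necessarily in $\mathcal D$, let $Bf$ and $\Psi f$ denote the $[0,\infty]$-valued essential suprema of $\{Bg:g\in\mathcal D,\,0\le g\le f\}$ and $\{\Psi g:g\in\mathcal D,\,0\le g\le f\}$; for $f\in\mathcal D$ this agrees with the given operators. Suppose that $\{P(t)\}_{t\ge0}$ has an invariant density $f_*$ (that is, $f_*\ge0$,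 $\|f_*\|=1$ and $P(t)f_*=f_*$ for all $t>0$) and that $K$ is stochastic (that is, linear and positive with $\|K(f,f_\partial)\|=\|(f,f_\partial)\|$ for $f,f_\partial\ge0$). If $(Bf_*,\Psi f_*)\in L^1\times L^1_\partial$, then $f_*\in\mathcal D$, $\|(Bf_*,\Psi f_*)\|>0$, and $(Bf_*,\Psi f_*)/\|(Bf_*,\Psi f_*)\|$ is an invariant density for $K$, i.e. it is nonnegative, has norm $1$ and is fixed by $K$. -/

import Mathlib

open MeasureTheory Filter Topology

noncomputable section

/-- The space `L¹(E, m)` of real integrable functions (modulo a.e. equality), with its `L¹`-norm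
and its a.e. order. -/
abbrev L1 {E : Type*} [MeasurableSpace E] (m : Measure E) : Type _ := Lp ℝ 1 m

section Semigroups

variable {E : Type*} [MeasurableSpace E] {m : Measure E}

/-- A substochastic semigroup on `L¹(E, m)`: a `C₀`-semigroup `{S(t)}_{t ≥ 0}` of positive operators
which do not increase the norm of nonnegative elements (only `t ≥ 0` is relevant). -/
structure IsSubstochasticSemigroup (S : ℝ → L1 m →L[ℝ] L1 m) : Prop where
  zero : S 0 = ContinuousLinearMap.id ℝ (L1 m)
  add : ∀ s t : ℝ, 0 ≤ s → 0 ≤ t → S (s + t) = (S s).comp (S t)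
  continuousOn : ∀ f : L1 m, ContinuousOn (fun t => S t f) (Set.Ici 0)
  nonneg : ∀ t : ℝ, 0 ≤ t → ∀ f : L1 m, 0 ≤ f → 0 ≤ S t f
  norm_le : ∀ t : ℝ, 0 ≤ t → ∀ f : L1 m, 0 ≤ f → ‖S t f‖ ≤ ‖f‖

/-- `G` is the infinitesimal generator of `S`: its domain consists of all `f` for which
`lim_{t ↓ 0} (S(t) f - f) / t` exists, and `G f` is this limit. -/
def IsGenerator (S : ℝ → L1 m →L[ℝ] L1 m) (G : L1 m →ₗ.[ℝ] L1 m) : Prop :=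
  ∀ f g : L1 m, (f, g) ∈ G.graph ↔
    Tendsto (fun t : ℝ => t⁻¹ • (S t f - f)) (𝓝[>] 0) (𝓝 g)

/-- `R` is the inverse of `r - G : 𝒟(G) → L¹`, and it is bounded as an operator on `L¹`. -/
structure IsResolvent (G : L1 m →ₗ.[ℝ] L1 m) (r : ℝ) (R : L1 m →ₗ[ℝ] G.domain) : Prop where
  right_inv : ∀ f : L1 m, r • (R f : L1 m) - G (R f) = f
  left_inv : ∀ u : G.domain, R (r • (u : L1 m) - G u) = u
  continuous : Continuous fun f : L1 m => (R f : L1 m)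

open Classical in
/-- The resolvent operator `R(r, G) = (r - G)⁻¹`, as an operator with values in `𝒟(G)`
(zero by convention if `r` is not in the resolvent set of `G`). -/
def resolventOp (G : L1 m →ₗ.[ℝ] L1 m) (r : ℝ) : L1 m →ₗ[ℝ] G.domain :=
  if h : ∃ R : L1 m →ₗ[ℝ] G.domain, IsResolvent G r R then h.choose else 0

/-- An invariant density for a semigroup: a nonnegative element of norm one which is fixed by every
operator of the semigroup. -/
structure IsInvariantDensity (P : ℝ → L1 m →L[ℝ] L1 m) (f : L1 m) : Prop where
  nonneg : 0 ≤ f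
  norm_eq : ‖f‖ = 1
  invariant : ∀ t : ℝ, 0 < t → P t f = f

end Semigroups

section Product

variable {E E' : Type*} [MeasurableSpace E] [MeasurableSpace E'] {m : Measure E} {m' : Measure E'}

/-- The norm `‖f‖ + ‖f'‖` of the space `L¹(E, m) × L¹(E', m')`. (The norm that Mathlib puts on the
product is the equivalent maximum norm.) -/
def pairNorm (x : L1 m × L1 m') : ℝ := ‖x.1‖ + ‖x.2‖

/-- A stochastic operator on `L¹(E, m) × L¹(E', m')`: a linear positive operator which preserves
the norm of nonnegative elements. -/
structure IsStochasticOp (K : L1 m × L1 m' → L1 m × L1 m') : Prop where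
  linear : IsLinearMap ℝ K
  nonneg : ∀ x, 0 ≤ x → 0 ≤ K x
  norm_eq : ∀ x, 0 ≤ x → pairNorm (K x) = pairNorm x

/-- An invariant density for an operator on `L¹(E, m) × L¹(E', m')`. -/
structure IsInvariantDensityOp (K : L1 m × L1 m' → L1 m × L1 m') (x : L1 m × L1 m') : Prop where
  nonneg : 0 ≤ x
  norm_eq : pairNorm x = 1
  invariant : K x = x

end Product

/-- The operators of the perturbation problem: the maximal operator `A` with domain `𝒟 ⊆ L¹(E, m)`,
a positive operator `B : 𝒟 → L¹(E, m)` and positive boundary operators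
`Ψ₀, Ψ : 𝒟 → L¹(E', m')`, where `(E', m')` is the boundary space. -/
structure BoundaryPerturbation {E E' : Type*} [MeasurableSpace E] [MeasurableSpace E']
    (m : Measure E) (m' : Measure E') where
  /-- The maximal operator, with domain `𝒟 = A.domain`. -/
  A : L1 m →ₗ.[ℝ] L1 m
  /-- The inner perturbation. -/
  B : A.domain →ₗ[ℝ] L1 m
  /-- The unperturbed boundary operator. -/
  Ψ₀ : A.domain →ₗ[ℝ] L1 m'
  /-- The perturbing boundary operator. -/
  Ψ : A.domain →ₗ[ℝ] L1 m'
  B_nonneg : ∀ f : A.domain, 0 ≤ (f : L1 m) → 0 ≤ B f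
  Ψ₀_nonneg : ∀ f : A.domain, 0 ≤ (f : L1 m) → 0 ≤ Ψ₀ f
  Ψ_nonneg : ∀ f : A.domain, 0 ≤ (f : L1 m) → 0 ≤ Ψ f

namespace BoundaryPerturbation

variable {E E' : Type*} [MeasurableSpace E] [MeasurableSpace E'] {m : Measure E} {m' : Measure E'}
  (T : BoundaryPerturbation m m')

/-- The operator `A₀`, the restriction of `A` to `𝒟(A₀) = {f ∈ 𝒟 : Ψ₀ f = 0}`. -/
def A₀ : L1 m →ₗ.[ℝ] L1 m :=
  T.A.domRestrict ((LinearMap.ker T.Ψ₀).map T.A.domain.subtype)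

/-- `Q` is a positive right inverse of `Ψ₀` restricted to `Ker(r - A)`: a positive linear operator
from `L¹(E', m')` to `Ker(r - A)` with `Ψ₀ Q f' = f'` for all `f'`. -/
structure IsPositiveRightInverse (r : ℝ) (Q : L1 m' →ₗ[ℝ] T.A.domain) : Prop where
  mem_ker : ∀ f' : L1 m', r • (Q f' : L1 m) - T.A (Q f') = 0
  right_inv : ∀ f' : L1 m', T.Ψ₀ (Q f') = f'
  nonneg : ∀ f' : L1 m', 0 ≤ f' → 0 ≤ (Q f' : L1 m)

/-- The three standing conditions on `A`, `B`, `Ψ₀`, `Ψ`. -/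
structure Conditions : Prop where
  /-- `A₀` is the generator of a substochastic semigroup on `L¹(E, m)`. -/
  generator : ∃ S : ℝ → L1 m →L[ℝ] L1 m, IsSubstochasticSemigroup S ∧ IsGenerator S T.A₀
  /-- Unless `Ψ₀` vanishes, it has a positive right inverse on `Ker(r - A)` for every `r > 0`. -/
  rightInverse : T.Ψ₀ ≠ 0 → ∀ r : ℝ, 0 < r →
    ∃ Q : L1 m' →ₗ[ℝ] T.A.domain, T.IsPositiveRightInverse r Q
  /-- `∫ (A f + B f) dm + ∫ (Ψ f - Ψ₀ f) dm' ≤ 0` for nonnegative `f ∈ 𝒟`. -/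
  integral_le : ∀ f : T.A.domain, 0 ≤ (f : L1 m) →
    (∫ x, (T.A f + T.B f : L1 m) x ∂m) + (∫ x, (T.Ψ f - T.Ψ₀ f : L1 m') x ∂m') ≤ 0

open Classical in
/-- The operator `Ψ(r)`: the positive right inverse of `Ψ₀` on `Ker(r - A)` if `Ψ₀` is not zero
(it is unique when `r` is in the resolvent set of `A₀`), and `Ψ(r) = 0` if `Ψ₀` is zero. -/
def Ψr (r : ℝ) : L1 m' →ₗ[ℝ] T.A.domain :=
  if h : T.Ψ₀ ≠ 0 ∧ ∃ Q : L1 m' →ₗ[ℝ] T.A.domain, T.IsPositiveRightInverse r Q then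
    h.2.choose else 0

theorem A₀_domain_le : T.A₀.domain ≤ T.A.domain := inf_le_right

/-- The operator `(f, f') ↦ R(r, A₀) f + Ψ(r) f'` from `L¹(E, m) × L¹(E', m')` to `𝒟`, that is, the
(first component of the) resolvent at `r` of the operator `(f, 0) ↦ (A f, -Ψ₀ f)`,
`f ∈ 𝒟`. -/
def 𝓡 (r : ℝ) : L1 m × L1 m' →ₗ[ℝ] T.A.domain :=
  (Submodule.inclusion T.A₀_domain_le ∘ₗ resolventOp T.A₀ r).coprod (T.Ψr r)

/-- The operator `f ↦ (B f, Ψ f)` from `𝒟` to `L¹(E, m) × L¹(E', m')`. -/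
def 𝓑 : T.A.domain →ₗ[ℝ] L1 m × L1 m' := T.B.prod T.Ψ

/-- `K (f, f') = lim_{r ↓ 0} 𝓑 (R(r, A₀) f + Ψ(r) f')`, the limit being in norm. -/
def K (x : L1 m × L1 m') : L1 m × L1 m' :=
  limUnder (𝓝[>] (0 : ℝ)) fun r => T.𝓑 (T.𝓡 r x)

/-- The partial sum `∑_{n = 0}^{N} (R(r, A₀) B + Ψ(r) Ψ)ⁿ R(r, A₀) f`, an element of `𝒟`. -/
def partialSum (r : ℝ) (N : ℕ) (f : L1 m) : T.A.domain :=
  ∑ n ∈ Finset.range (N + 1), ((T.𝓡 r ∘ₗ T.𝓑) ^ n) (T.𝓡 r (f, 0))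

/-- `P` is the perturbed semigroup: the substochastic semigroup whose generator `G` has the
resolvent `R(r, G) f = lim_{N → ∞} ∑_{n = 0}^{N} (R(r, A₀) B + Ψ(r) Ψ)ⁿ R(r, A₀) f`
for `r > 0` and `f ∈ L¹(E, m)`. As a semigroup is determined by the resolvent of its generator,
this determines `P(t)` for `t ≥ 0`. -/
def IsPerturbedSemigroup (P : ℝ → L1 m →L[ℝ] L1 m) : Prop :=
  IsSubstochasticSemigroup P ∧ ∃ G : L1 m →ₗ.[ℝ] L1 m, IsGenerator P G ∧
    ∀ r : ℝ, 0 < r → ∀ f : L1 m,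
      Tendsto (fun N : ℕ => (T.partialSum r N f : L1 m)) atTop (𝓝 (resolventOp G r f : L1 m))

end BoundaryPerturbation

section Extension

variable {E E' : Type*} [MeasurableSpace E] [MeasurableSpace E'] {m : Measure E} {m' : Measure E'}

/-- A positive operator `C : 𝒟 → L¹(E', m')` extends to all nonnegative `f ∈ L¹(E, m)`, with values
in the measurable functions `E' → [0, ∞]`, by the essential supremum
`C f = sup {C g : g ∈ 𝒟, 0 ≤ g ≤ f}`; it is the smallest monotone extension. `HasValue C f h` says
that this extension of `C` at `f` belongs to `L¹(E', m')` and equals `h`. -/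
def HasValue {D : Submodule ℝ (L1 m)} (C : D →ₗ[ℝ] L1 m') (f : L1 m) (h : L1 m') : Prop :=
  IsLUB {y : L1 m' | ∃ g : D, 0 ≤ (g : L1 m) ∧ (g : L1 m) ≤ f ∧ C g = y} h

/-- On nonnegative elements of the domain, the extension of a positive operator is the operator
itself. -/
theorem hasValue_self {D : Submodule ℝ (L1 m)} (C : D →ₗ[ℝ] L1 m')
    (hC : ∀ g : D, 0 ≤ (g : L1 m) → 0 ≤ C g) (f : D) (hf : 0 ≤ (f : L1 m)) :
    HasValue C (f : L1 m) (C f) := by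
  refine ⟨?_, fun z hz => hz ⟨f, hf, le_rfl, rfl⟩⟩
  rintro y ⟨g, _, hgf, rfl⟩
  have h := hC (f - g) (by simpa using hgf)
  rw [map_sub] at h
  exact sub_nonneg.mp h

end Extension

end

noncomputable section

/-! Write f for the invariant density and fix r > 0. Invariance gives r R(r, G) f = f, so f is the
limit of an increasing sequence g_N in 𝒟, the partial sums times r, with g_(N+1) = 𝓡 r ((r f, 0) + 𝓑
g_N). As 0 ≤ g_N ≤ f, the pairs 𝓑 g_N increase and stay below (b, p). They therefore converge in
norm by monotone convergence, and passing to the limit gives f = 𝓡 r y with y ≤ (r f + b, p)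
(`exists_𝓡_eq_of_tendsto`). So f lies in 𝒟, (b, p) = 𝓑 f, and the bound on y says A f + B f ≥ 0 and
Ψ f - Ψ₀ f ≥ 0. Condition (iii) makes the sum of their integrals nonpositive, hence both vanish
(`eq_of_le_of_𝓡_eq`).

Now (r f - A f, Ψ₀ f) = r (f, 0) + 𝓑 f, and applying 𝓑 𝓡 r gives 𝓑 f = r 𝓑 𝓡 r (f, 0) + 𝓑 𝓡 r 𝓑 f
for every r > 0. The first term is O(r), so K fixes 𝓑 f (`K_𝓑_eq_self`). If 𝓑 f were 0, the same
identity would give K (f, 0) = 0, which norm preservation excludes. -/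

instance L1.isOrderedModule {E : Type*} [MeasurableSpace E] {m : Measure E} :
    IsOrderedModule ℝ (L1 m) :=
  IsOrderedModule.of_smul_nonneg fun c hc f hf => by
    rw [← Lp.coeFn_nonneg] at hf ⊢
    filter_upwards [hf, Lp.coeFn_smul c f] with x hx hcx
    rw [hcx]
    exact mul_nonneg hc hx

/-! ### Resolvents of generators as Laplace transforms of the semigroup. -/

section Resolvent

variable {E : Type*} [MeasurableSpace E] {m : Measure E} {S : ℝ → L1 m →L[ℝ] L1 m}
  {G : L1 m →ₗ.[ℝ] L1 m} {r : ℝ}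

namespace IsSubstochasticSemigroup

/-- Positivity gives |S f| ≤ S |f|, which carries the bound from the positive cone to all of L¹. -/
theorem norm_apply_le (hS : IsSubstochasticSemigroup S) {t : ℝ} (ht : 0 ≤ t) (f : L1 m) :
    ‖S t f‖ ≤ ‖f‖ := by
  have hmono : ∀ {g h : L1 m}, g ≤ h → S t g ≤ S t h := fun {g h} hgh => by
    have := hS.nonneg t ht (h - g) (sub_nonneg.2 hgh)
    rw [map_sub] at this
    exact sub_nonneg.1 this
  have habs : |S t f| ≤ S t |f| := by
    refine abs_le'.2 ⟨hmono (le_abs_self f), ?_⟩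
    rw [← map_neg]
    exact hmono (neg_le_abs f)
  calc ‖S t f‖ ≤ ‖S t |f|‖ := by
        apply HasSolidNorm.solid
        rwa [abs_of_nonneg (hS.nonneg t ht _ (abs_nonneg f))]
    _ ≤ ‖|f|‖ := hS.norm_le t ht _ (abs_nonneg f)
    _ = ‖f‖ := norm_abs_eq_norm f

theorem continuousOn_exp_smul (hS : IsSubstochasticSemigroup S) (r : ℝ) (f : L1 m) :
    ContinuousOn (fun t => Real.exp (-r * t) • S t f) (Set.Ici 0) :=
  ContinuousOn.smul (by fun_prop : Continuous fun t : ℝ => Real.exp (-r * t)).continuousOn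
    (hS.continuousOn f)

theorem integrableOn_exp_smul (hS : IsSubstochasticSemigroup S) (hr : 0 < r) (f : L1 m) :
    IntegrableOn (fun t => Real.exp (-r * t) • S t f) (Set.Ioi 0) := by
  refine Integrable.mono' ((exp_neg_integrableOn_Ioi 0 hr).mul_const ‖f‖)
    (((hS.continuousOn_exp_smul r f).mono Set.Ioi_subset_Ici_self).aestronglyMeasurable
      measurableSet_Ioi) ?_
  filter_upwards [ae_restrict_mem measurableSet_Ioi] with t ht
  rw [norm_smul, Real.norm_of_nonneg (Real.exp_pos _).le]
  gcongr
  exact hS.norm_apply_le (le_of_lt ht) f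

end IsSubstochasticSemigroup

/-- The Laplace transform `∫₀^∞ e^{-rt} S(t) f dt` of a semigroup. -/
def laplaceTransform (S : ℝ → L1 m →L[ℝ] L1 m) (r : ℝ) (f : L1 m) : L1 m :=
  ∫ t in Set.Ioi (0 : ℝ), Real.exp (-r * t) • S t f

namespace IsSubstochasticSemigroup

theorem laplaceTransform_add (hS : IsSubstochasticSemigroup S) (hr : 0 < r) (f g : L1 m) :
    laplaceTransform S r (f + g) = laplaceTransform S r f + laplaceTransform S r g := by
  simp only [laplaceTransform, map_add, smul_add]
  exact integral_add (hS.integrableOn_exp_smul hr f) (hS.integrableOn_exp_smul hr g)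

theorem laplaceTransform_smul (S : ℝ → L1 m →L[ℝ] L1 m) (c : ℝ) (f : L1 m) :
    laplaceTransform S r (c • f) = c • laplaceTransform S r f := by
  simp only [laplaceTransform, map_smul, smul_comm _ c]
  exact integral_smul c _

theorem laplaceTransform_nonneg (hS : IsSubstochasticSemigroup S) {f : L1 m} (hf : 0 ≤ f) :
    0 ≤ laplaceTransform S r f := by
  refine integral_nonneg_of_ae ?_
  filter_upwards [ae_restrict_mem measurableSet_Ioi] with t ht
  exact smul_nonneg (Real.exp_pos _).le (hS.nonneg t (le_of_lt ht) f hf)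

theorem norm_laplaceTransform_le (hS : IsSubstochasticSemigroup S) (hr : 0 < r) (f : L1 m) :
    ‖laplaceTransform S r f‖ ≤ (∫ t in Set.Ioi (0 : ℝ), Real.exp (-r * t)) * ‖f‖ := by
  rw [← integral_mul_const]
  refine norm_integral_le_of_norm_le ((exp_neg_integrableOn_Ioi 0 hr).mul_const ‖f‖) ?_
  filter_upwards [ae_restrict_mem measurableSet_Ioi] with t ht
  rw [norm_smul, Real.norm_of_nonneg (Real.exp_pos _).le]
  gcongr
  exact hS.norm_apply_le (le_of_lt ht) f

/-- The Laplace transform of a substochastic semigroup as a bounded operator. -/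
def laplaceCLM (hS : IsSubstochasticSemigroup S) (hr : 0 < r) : L1 m →L[ℝ] L1 m :=
  LinearMap.mkContinuous
    { toFun := laplaceTransform S r
      map_add' := hS.laplaceTransform_add hr
      map_smul' := fun c f => laplaceTransform_smul S c f }
    _ (hS.norm_laplaceTransform_le hr)

theorem laplaceCLM_apply (hS : IsSubstochasticSemigroup S) (hr : 0 < r) (f : L1 m) :
    hS.laplaceCLM hr f = laplaceTransform S r f := rfl

theorem apply_laplaceTransform (hS : IsSubstochasticSemigroup S) (hr : 0 < r) {h : ℝ} (hh : 0 ≤ h)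
    (f : L1 m) : S h (laplaceTransform S r f) =
      ∫ t in Set.Ioi (0 : ℝ), Real.exp (-r * t) • S (t + h) f := by
  rw [laplaceTransform, ← ContinuousLinearMap.integral_comp_comm _ (hS.integrableOn_exp_smul hr f)]
  refine setIntegral_congr_fun measurableSet_Ioi fun t ht => ?_
  simp only [map_smul]
  rw [add_comm t h, hS.add h t hh (le_of_lt ht), ContinuousLinearMap.comp_apply]

theorem laplaceTransform_apply (hS : IsSubstochasticSemigroup S) (hr : 0 < r) {h : ℝ} (hh : 0 ≤ h)
    (f : L1 m) : laplaceTransform S r (S h f) = S h (laplaceTransform S r f) := by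
  rw [hS.apply_laplaceTransform hr hh]
  refine setIntegral_congr_fun measurableSet_Ioi fun t ht => ?_
  rw [hS.add t h (le_of_lt ht) hh, ContinuousLinearMap.comp_apply]

/-- Substituting t + h for t turns the shift into a factor and a truncated integral, so that the
right derivative at h = 0 follows from the product rule. -/
theorem apply_laplaceTransform_eq_sub (hS : IsSubstochasticSemigroup S) (hr : 0 < r) {h : ℝ}
    (hh : 0 ≤ h) (f : L1 m) : S h (laplaceTransform S r f) =
      Real.exp (r * h) •
        (laplaceTransform S r f - ∫ t in (0 : ℝ)..h, Real.exp (-r * t) • S t f) := by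
  have hmp := (measurePreserving_add_right (volume : Measure ℝ) h).setIntegral_preimage_emb
    (measurableEmbedding_addRight h) (fun t => Real.exp (-r * t) • S t f) (Set.Ioi h)
  have hpre : (fun t : ℝ => t + h) ⁻¹' Set.Ioi h = Set.Ioi 0 := by
    ext t; simp
  rw [hpre] at hmp
  rw [← intervalIntegral.integral_Ioi_sub_Ioi (hS.integrableOn_exp_smul hr f) hh, laplaceTransform,
    sub_sub_cancel, ← hmp, ← integral_smul, ← laplaceTransform, hS.apply_laplaceTransform hr hh]
  refine setIntegral_congr_fun measurableSet_Ioi fun t _ => ?_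
  rw [smul_smul, ← Real.exp_add]
  congr 2
  ring

theorem tendsto_laplaceTransform (hS : IsSubstochasticSemigroup S) (hr : 0 < r) (f : L1 m) :
    Tendsto (fun h : ℝ => h⁻¹ • (S h (laplaceTransform S r f) - laplaceTransform S r f)) (𝓝[>] 0)
      (𝓝 (r • laplaceTransform S r f - f)) := by
  have hcont := hS.continuousOn_exp_smul r f
  have hI : HasDerivWithinAt (fun h => ∫ t in (0 : ℝ)..h, Real.exp (-r * t) • S t f)
      (Real.exp (-r * 0) • S 0 f) (Set.Ici 0) 0 := by
    refine intervalIntegral.integral_hasDerivWithinAt_right (t := Set.Ioi 0) (by simp) ?_ ?_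
    · exact ⟨Set.Ioi 0, self_mem_nhdsWithin,
        (hcont.mono Set.Ioi_subset_Ici_self).aestronglyMeasurable measurableSet_Ioi⟩
    · exact (hcont 0 Set.self_mem_Ici).mono Set.Ioi_subset_Ici_self
  have hexp : HasDerivWithinAt (fun h : ℝ => Real.exp (r * h)) (Real.exp (r * 0) * (r * 1))
      (Set.Ici 0) 0 := ((hasDerivAt_id' (0 : ℝ)).const_mul r).exp.hasDerivWithinAt
  have hD := hexp.smul (hI.const_sub (laplaceTransform S r f))
  have hD' := (hD.mono Set.Ioi_subset_Ici_self)
  rw [hasDerivWithinAt_iff_tendsto_slope' (by simp)] at hD'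
  convert hD'.congr' ?_ using 2
  · simp [hS.zero, sub_eq_neg_add]
  · filter_upwards [self_mem_nhdsWithin] with h hh
    rw [slope_def_module, hS.apply_laplaceTransform_eq_sub hr (le_of_lt hh)]
    simp

theorem isResolvent_laplaceTransform (hS : IsSubstochasticSemigroup S) (hG : IsGenerator S G)
    (hr : 0 < r) : ∃ R : L1 m →ₗ[ℝ] G.domain, IsResolvent G r R ∧
      ∀ f, (R f : L1 m) = laplaceTransform S r f := by
  have hgraph : ∀ f, (laplaceTransform S r f, r • laplaceTransform S r f - f) ∈ G.graph :=
    fun f => (hG _ _).2 (hS.tendsto_laplaceTransform hr f)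
  have hmem : ∀ f, laplaceTransform S r f ∈ G.domain :=
    fun f => LinearPMap.mem_domain_of_mem_graph (hgraph f)
  refine ⟨(hS.laplaceCLM hr).toLinearMap.codRestrict G.domain hmem, ⟨fun f => ?_, fun u => ?_, ?_⟩,
    fun f => rfl⟩
  · have := (LinearPMap.mem_graph_iff G).1 (hgraph f)
    obtain ⟨y, hy, hGy⟩ := this
    have hy' : (hS.laplaceCLM hr).toLinearMap.codRestrict G.domain hmem f = y :=
      Subtype.ext hy.symm
    rw [hy', hGy, hy]
    simp
  -- The Laplace transform is bounded and commutes with the semigroup, so it maps the difference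
  -- quotients of u to those of its own image of u.
  · have h1 := ((hS.laplaceCLM hr).continuous.tendsto _).comp ((hG u (G u)).1 (G.mem_graph u))
    have h2 : Tendsto (fun h : ℝ => h⁻¹ • (S h (laplaceTransform S r (u : L1 m)) -
        laplaceTransform S r (u : L1 m))) (𝓝[>] 0) (𝓝 (laplaceTransform S r (G u))) := by
      refine h1.congr' ?_
      filter_upwards [self_mem_nhdsWithin] with h hh
      simp only [Function.comp, map_smul, map_sub, laplaceCLM_apply]
      rw [hS.laplaceTransform_apply hr (le_of_lt hh)]
    have h3 := tendsto_nhds_unique h2 (hS.tendsto_laplaceTransform hr u)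
    refine Subtype.ext ?_
    change hS.laplaceCLM hr (r • (u : L1 m) - G u) = u
    rw [map_sub, map_smul, laplaceCLM_apply, laplaceCLM_apply, h3, sub_sub_cancel]
  · exact (hS.laplaceCLM hr).continuous

theorem isResolvent_resolventOp (hS : IsSubstochasticSemigroup S) (hG : IsGenerator S G)
    (hr : 0 < r) : IsResolvent G r (resolventOp G r) := by
  obtain ⟨R, hR, -⟩ := hS.isResolvent_laplaceTransform hG hr
  have h : ∃ R : L1 m →ₗ[ℝ] G.domain, IsResolvent G r R := ⟨R, hR⟩
  rw [resolventOp, dif_pos h]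
  exact h.choose_spec

theorem resolventOp_nonneg (hS : IsSubstochasticSemigroup S) (hG : IsGenerator S G)
    (hr : 0 < r) {f : L1 m} (hf : 0 ≤ f) : 0 ≤ (resolventOp G r f : L1 m) := by
  obtain ⟨R, hR, hRf⟩ := hS.isResolvent_laplaceTransform hG hr
  -- The chosen resolvent agrees with the Laplace transform because r - G has only one inverse.
  have h := (hS.isResolvent_resolventOp hG hr).left_inv (R f)
  rw [hR.right_inv f] at h
  rw [h, hRf]
  exact hS.laplaceTransform_nonneg hf

end IsSubstochasticSemigroup

/-- The difference quotients of f vanish, so G f = 0 and (r - G) f = r f. -/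
theorem IsInvariantDensity.smul_resolventOp {f : L1 m} (hf : IsInvariantDensity S f)
    (hS : IsSubstochasticSemigroup S) (hG : IsGenerator S G) (hr : 0 < r) :
    r • (resolventOp G r f : L1 m) = f := by
  have h0 : (f, (0 : L1 m)) ∈ G.graph := by
    refine (hG f 0).2 (tendsto_const_nhds.congr' ?_)
    filter_upwards [self_mem_nhdsWithin] with t ht
    rw [hf.invariant t ht, sub_self, smul_zero]
  obtain ⟨u, hu, hGu⟩ := (LinearPMap.mem_graph_iff G).1 h0
  have h := (hS.isResolvent_resolventOp hG hr).left_inv u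
  simp only at hu hGu
  rw [hGu, sub_zero, hu, map_smul] at h
  rw [← Submodule.coe_smul, h, hu]

end Resolvent

/-! ### Additivity of the norm on the positive cone, and monotone convergence. -/

section Norm

variable {E E' : Type*} [MeasurableSpace E] [MeasurableSpace E'] {m : Measure E} {m' : Measure E'}

theorem L1.norm_eq_integral_of_nonneg {f : L1 m} (hf : 0 ≤ f) : ‖f‖ = ∫ x, f x ∂m := by
  rw [L1.norm_eq_integral_norm]
  refine integral_congr_ae ?_
  filter_upwards [(Lp.coeFn_nonneg f).2 hf] with x hx
  exact Real.norm_of_nonneg hx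

theorem L1.integral_add (f g : L1 m) :
    ∫ x, (f + g : L1 m) x ∂m = (∫ x, f x ∂m) + ∫ x, g x ∂m := by
  rw [← MeasureTheory.integral_add (L1.integrable_coeFn f) (L1.integrable_coeFn g)]
  exact integral_congr_ae (Lp.coeFn_add f g)

theorem L1.integral_sub (f g : L1 m) :
    ∫ x, (f - g : L1 m) x ∂m = (∫ x, f x ∂m) - ∫ x, g x ∂m := by
  rw [← MeasureTheory.integral_sub (L1.integrable_coeFn f) (L1.integrable_coeFn g)]
  exact integral_congr_ae (Lp.coeFn_sub f g)

theorem L1.integral_smul (c : ℝ) (f : L1 m) :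
    ∫ x, (c • f : L1 m) x ∂m = c * ∫ x, f x ∂m := by
  rw [← MeasureTheory.integral_const_mul]
  exact integral_congr_ae (Lp.coeFn_smul c f)

theorem L1.norm_add_of_nonneg {f g : L1 m} (hf : 0 ≤ f) (hg : 0 ≤ g) :
    ‖f + g‖ = ‖f‖ + ‖g‖ := by
  rw [norm_eq_integral_of_nonneg hf, norm_eq_integral_of_nonneg hg,
    norm_eq_integral_of_nonneg (add_nonneg hf hg), L1.integral_add]

/-- Monotone convergence: an increasing sequence bounded above converges in the norm of `L¹`. -/
theorem L1.exists_tendsto_of_monotone {f : ℕ → L1 m} (hf : Monotone f) {b : L1 m}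
    (hb : ∀ n, f n ≤ b) : ∃ g, Tendsto f atTop (𝓝 g) := by
  have hanti : Antitone fun n => ‖b - f n‖ := fun k n hkn => by
    have h := norm_add_of_nonneg (sub_nonneg.2 (hb n)) (sub_nonneg.2 (hf hkn))
    rw [sub_add_sub_cancel] at h
    change ‖b - f n‖ ≤ ‖b - f k‖
    rw [h]
    exact le_add_of_nonneg_right (norm_nonneg _)
  have hconv : Tendsto (fun n => ‖b - f n‖) atTop (𝓝 (⨅ n, ‖b - f n‖)) :=
    tendsto_atTop_ciInf hanti ⟨0, by rintro _ ⟨n, rfl⟩; exact norm_nonneg _⟩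
  have hcauchy := hconv.cauchySeq
  refine cauchySeq_tendsto_of_complete ?_
  rw [Metric.cauchySeq_iff'] at hcauchy ⊢
  intro ε hε
  obtain ⟨N, hN⟩ := hcauchy ε hε
  refine ⟨N, fun n hn => ?_⟩
  -- Additivity gives ‖f n - f N‖ = ‖b - f N‖ - ‖b - f n‖, a difference of terms of a convergent
  -- real sequence.
  have h := norm_add_of_nonneg (sub_nonneg.2 (hb n)) (sub_nonneg.2 (hf hn))
  rw [sub_add_sub_cancel] at h
  have h2 := hN n hn
  rw [dist_comm, Real.dist_eq, h, add_sub_cancel_left, abs_of_nonneg (norm_nonneg _)] at h2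
  rwa [dist_eq_norm]

theorem pairNorm_nonneg (x : L1 m × L1 m') : 0 ≤ pairNorm x :=
  add_nonneg (norm_nonneg _) (norm_nonneg _)

theorem pairNorm_eq_zero {x : L1 m × L1 m'} : pairNorm x = 0 ↔ x = 0 := by
  rw [pairNorm, add_eq_zero_iff_of_nonneg (norm_nonneg _) (norm_nonneg _), norm_eq_zero,
    norm_eq_zero, Prod.ext_iff]
  rfl

theorem pairNorm_smul (c : ℝ) (x : L1 m × L1 m') : pairNorm (c • x) = |c| * pairNorm x := by
  simp [pairNorm, norm_smul, mul_add]

theorem continuous_pairNorm : Continuous (pairNorm : L1 m × L1 m' → ℝ) := by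
  unfold pairNorm
  fun_prop

theorem norm_le_pairNorm (x : L1 m × L1 m') : ‖x‖ ≤ pairNorm x :=
  max_le (le_add_of_nonneg_right (norm_nonneg _)) (le_add_of_nonneg_left (norm_nonneg _))

theorem exists_tendsto_prod_of_monotone {x : ℕ → L1 m × L1 m'} (hx : Monotone x)
    {b : L1 m × L1 m'} (hb : ∀ n, x n ≤ b) : ∃ y, Tendsto x atTop (𝓝 y) := by
  obtain ⟨y₁, h₁⟩ := L1.exists_tendsto_of_monotone (fun _ _ h => (hx h).1) fun n => (hb n).1
  obtain ⟨y₂, h₂⟩ := L1.exists_tendsto_of_monotone (fun _ _ h => (hx h).2) fun n => (hb n).2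
  exact ⟨(y₁, y₂), h₁.prodMk_nhds h₂⟩

end Norm

/-! ### The boundary resolvent `𝓡` and its estimates. -/

namespace BoundaryPerturbation

variable {E E' : Type*} [MeasurableSpace E] [MeasurableSpace E'] {m : Measure E} {m' : Measure E'}
  {T : BoundaryPerturbation m m'} {r : ℝ}

theorem Ψ₀_eq_zero_of_mem_A₀_domain {u : L1 m} (hu : u ∈ T.A₀.domain) :
    T.Ψ₀ ⟨u, T.A₀_domain_le hu⟩ = 0 := by
  obtain ⟨v, hv, rfl⟩ := hu.1
  exact hv

theorem mem_A₀_domain {u : T.A.domain} (hu : T.Ψ₀ u = 0) : (u : L1 m) ∈ T.A₀.domain :=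
  ⟨⟨u, hu, rfl⟩, u.2⟩

theorem A₀_apply {u : L1 m} (hu : u ∈ T.A₀.domain) :
    T.A₀ ⟨u, hu⟩ = T.A ⟨u, T.A₀_domain_le hu⟩ := rfl

theorem 𝓑_nonneg {u : T.A.domain} (hu : 0 ≤ (u : L1 m)) : 0 ≤ T.𝓑 u :=
  ⟨T.B_nonneg u hu, T.Ψ_nonneg u hu⟩

theorem 𝓑_mono {u v : T.A.domain} (h : (u : L1 m) ≤ v) : T.𝓑 u ≤ T.𝓑 v := by
  rw [← sub_nonneg, ← map_sub]
  exact 𝓑_nonneg (sub_nonneg.2 h)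

theorem 𝓡_apply (r : ℝ) (x : L1 m × L1 m') : T.𝓡 r x =
    Submodule.inclusion T.A₀_domain_le (resolventOp T.A₀ r x.1) + T.Ψr r x.2 := rfl

/-- The partial sums satisfy the recursion of the fixed point equation. -/
theorem partialSum_succ (r : ℝ) (N : ℕ) (f : L1 m) :
    T.partialSum r (N + 1) f = T.𝓡 r ((f, 0) + T.𝓑 (T.partialSum r N f)) := by
  rw [map_add, partialSum, Finset.sum_range_succ', partialSum, map_sum, map_sum, add_comm]
  simp [pow_succ', Module.End.mul_apply]

namespace Conditions

theorem isPositiveRightInverse (hT : T.Conditions) (hΨ : T.Ψ₀ ≠ 0) (hr : 0 < r) :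
    T.IsPositiveRightInverse r (T.Ψr r) := by
  have h : T.Ψ₀ ≠ 0 ∧ ∃ Q : L1 m' →ₗ[ℝ] T.A.domain, T.IsPositiveRightInverse r Q :=
    ⟨hΨ, hT.rightInverse hΨ r hr⟩
  rw [Ψr, dif_pos h]
  exact h.2.choose_spec

theorem isResolvent (hT : T.Conditions) (hr : 0 < r) :
    IsResolvent T.A₀ r (resolventOp T.A₀ r) := by
  obtain ⟨S, hS, hG⟩ := hT.generator
  exact hS.isResolvent_resolventOp hG hr

theorem smul_sub_A_𝓡 (hT : T.Conditions) (hr : 0 < r) (x : L1 m × L1 m') :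
    r • (T.𝓡 r x : L1 m) - T.A (T.𝓡 r x) = x.1 := by
  have h1 : r • (T.Ψr r x.2 : L1 m) - T.A (T.Ψr r x.2) = 0 := by
    by_cases hΨ : T.Ψ₀ = 0
    · simp [Ψr, hΨ]
    · exact (hT.isPositiveRightInverse hΨ hr).mem_ker x.2
  have h2 := (hT.isResolvent hr).right_inv x.1
  have h3 : T.A₀ (resolventOp T.A₀ r x.1) =
    T.A (Submodule.inclusion T.A₀_domain_le (resolventOp T.A₀ r x.1)) := rfl
  rw [𝓡_apply, LinearPMap.map_add, Submodule.coe_add, smul_add, add_sub_add_comm, h1, add_zero,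
    ← h3]
  exact h2

/-- When Ψ₀ = 0 the left side is 0, so the identity needs a trivial boundary space; this is the role
of `h0`. -/
theorem Ψ₀_𝓡 (hT : T.Conditions) (h0 : T.Ψ₀ = 0 → ∀ y : L1 m', y = 0) (hr : 0 < r)
    (x : L1 m × L1 m') : T.Ψ₀ (T.𝓡 r x) = x.2 := by
  by_cases hΨ : T.Ψ₀ = 0
  · rw [h0 hΨ x.2]
    exact h0 hΨ _
  · rw [𝓡_apply, map_add, (hT.isPositiveRightInverse hΨ hr).right_inv]
    have : T.Ψ₀ (Submodule.inclusion T.A₀_domain_le (resolventOp T.A₀ r x.1)) = 0 :=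
      Ψ₀_eq_zero_of_mem_A₀_domain (resolventOp T.A₀ r x.1).2
    rw [this, zero_add]

theorem 𝓡_nonneg (hT : T.Conditions) (hr : 0 < r) {x : L1 m × L1 m'} (hx : 0 ≤ x) :
    0 ≤ (T.𝓡 r x : L1 m) := by
  obtain ⟨S, hS, hG⟩ := hT.generator
  rw [𝓡_apply, Submodule.coe_add]
  refine add_nonneg (hS.resolventOp_nonneg hG hr hx.1) ?_
  by_cases hΨ : T.Ψ₀ = 0
  · simp [Ψr, hΨ]
  · exact (hT.isPositiveRightInverse hΨ hr).nonneg x.2 hx.2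

theorem 𝓡_mono (hT : T.Conditions) (hr : 0 < r) {x y : L1 m × L1 m'} (h : x ≤ y) :
    (T.𝓡 r x : L1 m) ≤ T.𝓡 r y := by
  rw [← sub_nonneg, ← Submodule.coe_sub, ← map_sub]
  exact hT.𝓡_nonneg hr (sub_nonneg.2 h)

/-- `𝓡 r` is a left inverse of `u ↦ (r u - A u, Ψ₀ u)`. -/
theorem 𝓡_smul_sub_A (hT : T.Conditions) (h0 : T.Ψ₀ = 0 → ∀ y : L1 m', y = 0) (hr : 0 < r)
    (u : T.A.domain) : T.𝓡 r (r • (u : L1 m) - T.A u, T.Ψ₀ u) = u := by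
  set v := T.𝓡 r (r • (u : L1 m) - T.A u, T.Ψ₀ u) with hv
  have h1 : T.Ψ₀ (v - u) = 0 := by rw [map_sub, hv, hT.Ψ₀_𝓡 h0 hr, sub_self]
  have h2 := hT.smul_sub_A_𝓡 hr (r • (u : L1 m) - T.A u, T.Ψ₀ u)
  rw [← hv] at h2
  -- The difference v - u lies in 𝒟(A₀) and is annihilated by r - A₀, which is injective.
  have h3 := (hT.isResolvent hr).left_inv ⟨_, mem_A₀_domain h1⟩
  have h4 : T.A₀ ⟨_, mem_A₀_domain h1⟩ = T.A v - T.A u := by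
    rw [A₀_apply, ← LinearPMap.map_sub]
  have h5 : r • ((v - u : T.A.domain) : L1 m) - (T.A v - T.A u) = 0 := by
    rw [Submodule.coe_sub, smul_sub, sub_sub_sub_comm, h2, sub_self]
  rw [h4, h5, map_zero] at h3
  exact sub_eq_zero.1 (Subtype.ext (congrArg Subtype.val h3).symm)

/-- The integral condition for nonnegative elements of the domain, in terms of norms. -/
theorem norm_add_pairNorm_𝓡_le (hT : T.Conditions) (h0 : T.Ψ₀ = 0 → ∀ y : L1 m', y = 0)
    (hr : 0 < r) {x : L1 m × L1 m'} (hx : 0 ≤ x) :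
    r * ‖(T.𝓡 r x : L1 m)‖ + pairNorm (T.𝓑 (T.𝓡 r x)) ≤ pairNorm x := by
  have hu := hT.𝓡_nonneg hr hx
  have hi := hT.integral_le _ hu
  have hA : T.A (T.𝓡 r x) = r • (T.𝓡 r x : L1 m) - x.1 := by
    rw [← hT.smul_sub_A_𝓡 hr x, sub_sub_cancel]
  rw [L1.integral_add, L1.integral_sub, hT.Ψ₀_𝓡 h0 hr, hA, L1.integral_sub, L1.integral_smul] at hi
  rw [pairNorm, pairNorm, L1.norm_eq_integral_of_nonneg hu, L1.norm_eq_integral_of_nonneg hx.1,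
    L1.norm_eq_integral_of_nonneg hx.2, L1.norm_eq_integral_of_nonneg (𝓑_nonneg hu).1,
    L1.norm_eq_integral_of_nonneg (𝓑_nonneg hu).2]
  change _ + ((∫ z, (T.B _ : L1 m) z ∂m) + ∫ z, (T.Ψ _ : L1 m') z ∂m') ≤ _
  linarith

theorem norm_𝓡_le (hT : T.Conditions) (h0 : T.Ψ₀ = 0 → ∀ y : L1 m', y = 0)
    (hr : 0 < r) {x : L1 m × L1 m'} (hx : 0 ≤ x) : ‖(T.𝓡 r x : L1 m)‖ ≤ r⁻¹ * pairNorm x := by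
  rw [← div_eq_inv_mul, le_div_iff₀' hr]
  exact le_trans (le_add_of_nonneg_right (pairNorm_nonneg _)) (hT.norm_add_pairNorm_𝓡_le h0 hr hx)

/-- The norm bound is available for nonnegative arguments only; monotonicity makes y - x n
nonnegative. -/
theorem tendsto_𝓡_of_monotone (hT : T.Conditions) (h0 : T.Ψ₀ = 0 → ∀ y : L1 m', y = 0)
    (hr : 0 < r) {x : ℕ → L1 m × L1 m'} {y : L1 m × L1 m'} (hx : Monotone x)
    (hxy : Tendsto x atTop (𝓝 y)) :
    Tendsto (fun n => (T.𝓡 r (x n) : L1 m)) atTop (𝓝 (T.𝓡 r y : L1 m)) := by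
  have hle : ∀ n, x n ≤ y := fun n =>
    ⟨(hx.ge_of_tendsto hxy n).1, (hx.ge_of_tendsto hxy n).2⟩
  have hlim : Tendsto (fun n => r⁻¹ * pairNorm (y - x n)) atTop (𝓝 0) := by
    have h := ((continuous_pairNorm.tendsto (y - y)).comp (hxy.const_sub y)).const_mul r⁻¹
    rwa [sub_self, pairNorm_eq_zero.2 rfl, mul_zero] at h
  rw [tendsto_iff_norm_sub_tendsto_zero]
  refine squeeze_zero (fun _ => norm_nonneg _) (fun n => ?_) hlim
  rw [norm_sub_rev, ← Submodule.coe_sub, ← map_sub]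
  exact hT.norm_𝓡_le h0 hr (sub_nonneg.2 (hle n))

/-- If `K` preserves the norm, then `Ψ₀ = 0` forces the boundary space to be trivial. -/
theorem eq_zero_of_Ψ₀_eq_zero (hK : IsStochasticOp T.K) (hΨ : T.Ψ₀ = 0)
    (y : L1 m') : y = 0 := by
  have key : ∀ z : L1 m', 0 ≤ z → z = 0 := fun z hz => by
    -- With Ψ₀ = 0 also Ψ(r) = 0, so 𝓡 r (0, z) = 0 for every r.
    have h : T.K (0, z) = 0 := by
      refine Tendsto.limUnder_eq (tendsto_const_nhds.congr fun r => ?_)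
      simp [𝓡_apply, Ψr, hΨ]
    have h2 := hK.norm_eq (0, z) ⟨le_rfl, hz⟩
    rw [h, pairNorm_eq_zero.2 rfl, eq_comm, pairNorm_eq_zero] at h2
    exact congrArg Prod.snd h2
  rw [← posPart_sub_negPart y, key _ (posPart_nonneg y), key _ (negPart_nonneg y), sub_zero]

/-- The partial sums of a nonnegative element are nonnegative and increasing. -/
theorem partialSum_nonneg_monotone (hT : T.Conditions) (hr : 0 < r) {f : L1 m} (hf : 0 ≤ f) :
    (∀ N, 0 ≤ (T.partialSum r N f : L1 m)) ∧ Monotone fun N => (T.partialSum r N f : L1 m) := by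
  have hfp : (0 : L1 m × L1 m') ≤ (f, (0 : L1 m')) := ⟨hf, le_refl (0 : L1 m')⟩
  have hzero : T.partialSum r 0 f = T.𝓡 r (f, 0) := by
    rw [partialSum, zero_add, Finset.sum_range_one, pow_zero, Module.End.one_apply]
  have hg0 : (0 : L1 m) ≤ T.partialSum r 0 f := hzero ▸ hT.𝓡_nonneg hr hfp
  have hmono : Monotone fun N => (T.partialSum r N f : L1 m) := by
    refine monotone_nat_of_le_succ fun N => ?_
    induction N with
    | zero =>
      rw [partialSum_succ]
      nth_rewrite 1 [hzero]
      exact hT.𝓡_mono hr (le_add_of_nonneg_right (𝓑_nonneg hg0))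
    | succ N ih =>
      rw [partialSum_succ, partialSum_succ r (N + 1)]
      exact hT.𝓡_mono hr (add_le_add le_rfl (𝓑_mono ih))
  exact ⟨fun N => hg0.trans (hmono (Nat.zero_le N)), hmono⟩

/-! ### Membership of the limit in the domain. -/

/-- A limit of an increasing sequence of nonnegative elements satisfying the fixed point recursion
is in the range of `𝓡 r`, provided that it has finite values of `B` and `Ψ`. -/
theorem exists_𝓡_eq_of_tendsto (hT : T.Conditions) (h0 : T.Ψ₀ = 0 → ∀ y : L1 m', y = 0)
    (hr : 0 < r) {z : L1 m} {f : L1 m} {g : ℕ → T.A.domain} (hg : ∀ N, 0 ≤ (g N : L1 m))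
    (hmono : Monotone fun N => (g N : L1 m))
    (hsucc : ∀ N, g (N + 1) = T.𝓡 r ((z, 0) + T.𝓑 (g N)))
    (hlim : Tendsto (fun N => (g N : L1 m)) atTop (𝓝 f))
    {b : L1 m} (hb : HasValue T.B f b) {p : L1 m'} (hp : HasValue T.Ψ f p) :
    ∃ y : L1 m × L1 m', y ≤ (z + b, p) ∧ (T.𝓡 r y : L1 m) = f := by
  have hxmono : Monotone fun N => (z, 0) + T.𝓑 (g N) :=
    fun k n hkn => add_le_add le_rfl (𝓑_mono (hmono hkn))
  have hgle : ∀ N, (g N : L1 m) ≤ f := fun N => hmono.ge_of_tendsto hlim N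
  -- Each `g N` is admissible in the suprema that define b and p.
  have hxle : ∀ N, (z, 0) + T.𝓑 (g N) ≤ (z + b, p) := fun N =>
    ⟨add_le_add le_rfl (hb.1 ⟨g N, hg N, hgle N, rfl⟩),
      (zero_add (T.Ψ (g N))).le.trans (hp.1 ⟨g N, hg N, hgle N, rfl⟩)⟩
  obtain ⟨y, hy⟩ := exists_tendsto_prod_of_monotone hxmono hxle
  refine ⟨y, le_of_tendsto' hy hxle, ?_⟩
  refine tendsto_nhds_unique (hT.tendsto_𝓡_of_monotone h0 hr hxmono hy) ?_
  refine ((tendsto_add_atTop_iff_nat 1).2 hlim).congr fun N => ?_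
  rw [hsucc]

/-- The integral condition turns the inequality `y ≤ (r u + B u, Ψ u)` for `u = 𝓡 r y` into an
equality. -/
theorem eq_of_le_of_𝓡_eq (hT : T.Conditions) (h0 : T.Ψ₀ = 0 → ∀ y : L1 m', y = 0)
    (hr : 0 < r) {u : T.A.domain} (hu : 0 ≤ (u : L1 m)) {y : L1 m × L1 m'}
    (hy : y ≤ (r • (u : L1 m) + T.B u, T.Ψ u)) (hyu : T.𝓡 r y = u) :
    T.A u = -T.B u ∧ T.Ψ₀ u = T.Ψ u := by
  have hA := hT.smul_sub_A_𝓡 hr y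
  have hΨ₀ := hT.Ψ₀_𝓡 h0 hr y
  rw [hyu] at hA hΨ₀
  have h1 : 0 ≤ T.A u + T.B u := by
    have h : y.1 ≤ r • (u : L1 m) + T.B u := hy.1
    rwa [← hA, sub_eq_add_neg, add_le_add_iff_left, neg_le_iff_add_nonneg'] at h
  have h2 : 0 ≤ T.Ψ u - T.Ψ₀ u := hΨ₀ ▸ sub_nonneg.2 hy.2
  have hi := hT.integral_le u hu
  rw [← L1.norm_eq_integral_of_nonneg h1, ← L1.norm_eq_integral_of_nonneg h2] at hi
  have hz1 : ‖(T.A u + T.B u : L1 m)‖ = 0 :=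
    le_antisymm (by linarith [norm_nonneg (T.Ψ u - T.Ψ₀ u)]) (norm_nonneg _)
  have hz2 : ‖T.Ψ u - T.Ψ₀ u‖ = 0 :=
    le_antisymm (by linarith [norm_nonneg (T.A u + T.B u)]) (norm_nonneg _)
  exact ⟨eq_neg_iff_add_eq_zero.2 (norm_eq_zero.1 hz1), (sub_eq_zero.1 (norm_eq_zero.1 hz2)).symm⟩

/-- A limit of the scaled partial sums which has finite values of `B` and `Ψ` lies in the domain,
and is annihilated by `A + B` and by `Ψ₀ - Ψ`. -/
theorem mem_domain_of_tendsto_partialSum (hT : T.Conditions)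
    (h0 : T.Ψ₀ = 0 → ∀ y : L1 m', y = 0) (hr : 0 < r) {f : L1 m} (hf : 0 ≤ f)
    (hlim : Tendsto (fun N => r • (T.partialSum r N f : L1 m)) atTop (𝓝 f))
    {b : L1 m} (hb : HasValue T.B f b) {p : L1 m'} (hp : HasValue T.Ψ f p) :
    ∃ hD : f ∈ T.A.domain, T.B ⟨f, hD⟩ = b ∧ T.Ψ ⟨f, hD⟩ = p ∧
      T.A ⟨f, hD⟩ = -T.B ⟨f, hD⟩ ∧ T.Ψ₀ ⟨f, hD⟩ = T.Ψ ⟨f, hD⟩ := by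
  obtain ⟨hnn, hmono⟩ := hT.partialSum_nonneg_monotone hr hf
  have hsucc : ∀ N, r • T.partialSum r (N + 1) f =
      T.𝓡 r ((r • f, 0) + T.𝓑 (r • T.partialSum r N f)) := fun N => by
    rw [partialSum_succ, ← map_smul, smul_add, ← map_smul, Prod.smul_mk, smul_zero]
  obtain ⟨y, hy, hfy⟩ := hT.exists_𝓡_eq_of_tendsto h0 hr (g := fun N => r • T.partialSum r N f)
    (fun N => smul_nonneg hr.le (hnn N))
    (fun _ _ h => smul_le_smul_of_nonneg_left (hmono h) hr.le) hsucc hlim hb hp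
  have hD : f ∈ T.A.domain := hfy ▸ (T.𝓡 r y).2
  have hB : T.B ⟨f, hD⟩ = b := (hasValue_self T.B T.B_nonneg ⟨f, hD⟩ hf).unique hb
  have hΨ : T.Ψ ⟨f, hD⟩ = p := (hasValue_self T.Ψ T.Ψ_nonneg ⟨f, hD⟩ hf).unique hp
  refine ⟨hD, hB, hΨ, hT.eq_of_le_of_𝓡_eq h0 hr hf (y := y) ?_ (Subtype.ext hfy)⟩
  rwa [hB, hΨ]

/-! ### The action of K on elements annihilated by A + B and Ψ₀ - Ψ. -/

/-- If `u ∈ 𝒟` satisfies `A u + B u = 0` and `Ψ₀ u = Ψ u`, then `K` fixes `(B u, Ψ u)`. -/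
theorem K_𝓑_eq_self (hT : T.Conditions) (h0 : T.Ψ₀ = 0 → ∀ y : L1 m', y = 0) {u : T.A.domain}
    (hu : 0 ≤ (u : L1 m)) (hA : T.A u = -T.B u) (hΨ : T.Ψ₀ u = T.Ψ u) :
    T.K (T.𝓑 u) = T.𝓑 u := by
  have hup : (0 : L1 m × L1 m') ≤ ((u : L1 m), (0 : L1 m')) := ⟨hu, le_refl (0 : L1 m')⟩
  have hrep : ∀ r : ℝ, 0 < r →
      T.𝓑 u - r • T.𝓑 (T.𝓡 r (u, 0)) = T.𝓑 (T.𝓡 r (T.𝓑 u)) := fun r hr => by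
    have h := hT.𝓡_smul_sub_A h0 hr u
    have h2 : (r • (u : L1 m) - T.A u, T.Ψ₀ u) = r • ((u : L1 m), (0 : L1 m')) + T.𝓑 u := by
      rw [hA, hΨ, sub_neg_eq_add, Prod.smul_mk, smul_zero]
      exact Prod.ext rfl (zero_add _).symm
    rw [h2, map_add, map_smul] at h
    nth_rewrite 1 [← h]
    rw [map_add, map_smul, add_sub_cancel_left]
  -- By the integral condition 𝓑 𝓡 r does not increase the pair norm of (u, 0), uniformly in r.
  have hbound : Tendsto (fun r : ℝ => r • T.𝓑 (T.𝓡 r (u, 0))) (𝓝[>] 0) (𝓝 0) := by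
    have hlim : Tendsto (fun r : ℝ => r * pairNorm ((u : L1 m), (0 : L1 m'))) (𝓝[>] 0) (𝓝 0) := by
      have h : Tendsto (fun r : ℝ => r) (𝓝[>] 0) (𝓝 0) := nhdsWithin_le_nhds
      simpa using h.mul_const (pairNorm ((u : L1 m), (0 : L1 m')))
    refine squeeze_zero_norm' ?_ hlim
    filter_upwards [self_mem_nhdsWithin] with r hr
    rw [norm_smul, Real.norm_of_nonneg (le_of_lt hr)]
    refine mul_le_mul_of_nonneg_left ((norm_le_pairNorm _).trans ?_) (le_of_lt hr)
    exact (le_add_of_nonneg_left (mul_nonneg (le_of_lt hr) (norm_nonneg _))).trans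
      (hT.norm_add_pairNorm_𝓡_le h0 hr hup)
  refine Tendsto.limUnder_eq ?_
  have h := hbound.const_sub (T.𝓑 u)
  rw [sub_zero] at h
  refine h.congr' ?_
  filter_upwards [self_mem_nhdsWithin] with r hr using hrep r hr

/-- If `A u = 0`, `Ψ₀ u = 0`, `B u = 0` and `Ψ u = 0`, then `K (u, 0) = 0`. -/
theorem K_eq_zero (hT : T.Conditions) (h0 : T.Ψ₀ = 0 → ∀ y : L1 m', y = 0) {u : T.A.domain}
    (hA : T.A u = 0) (hΨ : T.Ψ₀ u = 0) (hu : T.𝓑 u = 0) : T.K (u, 0) = 0 := by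
  refine Tendsto.limUnder_eq (tendsto_const_nhds.congr' ?_)
  filter_upwards [self_mem_nhdsWithin] with r hr
  have h := hT.𝓡_smul_sub_A h0 hr u
  have h2 : (r • (u : L1 m) - T.A u, T.Ψ₀ u) = r • ((u : L1 m), (0 : L1 m')) := by
    rw [hA, hΨ, sub_zero, Prod.smul_mk, smul_zero]
  rw [h2, map_smul] at h
  -- Here r 𝓡 r (u, 0) = u, so r 𝓑 𝓡 r (u, 0) = 𝓑 u = 0.
  have h3 := congrArg T.𝓑 h
  rw [map_smul, hu] at h3
  exact ((smul_eq_zero.1 h3).resolve_left (ne_of_gt hr)).symm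

end Conditions

end BoundaryPerturbation

end

theorem theorem3p10
    {E E' : Type*} [MeasurableSpace E] [MeasurableSpace E']
    (m : Measure E) (m' : Measure E') [SigmaFinite m] [SigmaFinite m']
    (T : BoundaryPerturbation m m') (hT : T.Conditions)
    (P : ℝ → L1 m →L[ℝ] L1 m) (hP : T.IsPerturbedSemigroup P)
    (fStar : L1 m) (hf : IsInvariantDensity P fStar)
    (hK : IsStochasticOp T.K)
    (b : L1 m) (hb : HasValue T.B fStar b)
    (p : L1 m') (hp : HasValue T.Ψ fStar p) :
    ∃ hD : fStar ∈ T.A.domain,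
      T.B ⟨fStar, hD⟩ = b ∧ T.Ψ ⟨fStar, hD⟩ = p ∧
      0 < pairNorm (b, p) ∧
      IsInvariantDensityOp T.K ((pairNorm (b, p))⁻¹ • (b, p)) := by
  have h0 : T.Ψ₀ = 0 → ∀ y : L1 m', y = 0 :=
    BoundaryPerturbation.Conditions.eq_zero_of_Ψ₀_eq_zero hK
  obtain ⟨hPS, G, hG, hlim⟩ := hP
  -- Any r > 0 would serve here; r = 1 is an arbitrary choice.
  have hlim1 : Tendsto (fun N => (1 : ℝ) • (T.partialSum 1 N fStar : L1 m)) atTop (𝓝 fStar) := by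
    have h := (hlim 1 one_pos fStar).const_smul (1 : ℝ)
    rwa [hf.smul_resolventOp hPS hG one_pos] at h
  obtain ⟨hD, hB, hΨ, hA, hΨ₀⟩ :=
    hT.mem_domain_of_tendsto_partialSum h0 one_pos hf.nonneg hlim1 hb hp
  have h𝓑 : T.𝓑 ⟨fStar, hD⟩ = (b, p) := Prod.ext hB hΨ
  have hnonneg : 0 ≤ (b, p) := h𝓑 ▸ BoundaryPerturbation.𝓑_nonneg (u := ⟨fStar, hD⟩) hf.nonneg
  have hfix : T.K (b, p) = (b, p) := by
    rw [← h𝓑]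
    exact hT.K_𝓑_eq_self h0 hf.nonneg hA hΨ₀
  have hpos : 0 < pairNorm (b, p) := by
    refine lt_of_le_of_ne (pairNorm_nonneg _) fun h => ?_
    have hbp := pairNorm_eq_zero.1 h.symm
    have hb0 : b = 0 := congrArg Prod.fst hbp
    have hp0 : p = 0 := congrArg Prod.snd hbp
    have hK0 := hT.K_eq_zero h0 (u := ⟨fStar, hD⟩) (by rw [hA, hB, hb0, neg_zero])
      (by rw [hΨ₀, hΨ, hp0]) (h𝓑.trans hbp)
    have hn := hK.norm_eq (fStar, 0) ⟨hf.nonneg, le_refl (0 : L1 m')⟩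
    rw [hK0, pairNorm_eq_zero.2 rfl, pairNorm, hf.norm_eq, norm_zero, add_zero] at hn
    exact zero_ne_one hn
  refine ⟨hD, hB, hΨ, hpos, ?_, ?_, ?_⟩
  · exact ⟨smul_nonneg (inv_nonneg.2 hpos.le) hnonneg.1,
      smul_nonneg (inv_nonneg.2 hpos.le) hnonneg.2⟩
  · rw [pairNorm_smul, abs_of_pos (inv_pos.2 hpos), inv_mul_cancel₀ hpos.ne']
  · rw [hK.linear.map_smul, hfix]
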